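/- Let $M$ be a smooth manifold with a smooth Lorentzian metric $g$ of signature $(-,+,\dots,+)$ and a time orientation (a continuous timelike vector field $T$). A tangent vector $v\neq 0$ of $M$ is future-causal if $g(v,v)\le 0$ and $g(T,v)<0$. Let $m$ be a positive integer, $S$ a smooth manifold of dimension $m$ (compactness is not needed) with a smooth Riemannian metric $h$, and $f:M\to\mathbb R$ a function of class $C^2$. Manifolds are finite-dimensional and without boundary. For a metric write $\mathrm{Ric}$, $R$ and $G=\mathrm{Ric}-\tfrac12 R\,(\text{metric})$ for its Ricci, scalar and Einstein curvature, and put on $(M,g)$ $$\mathrm{Ric}^{f,m}=\mathrm{Ric}+\mathrm{Hess} f-\tfrac1m\,df\otimes df,\qquad R^{f,m}=R+2\,\square_g f-\tfrac{m+1}{m}|\nabla f|_g^2,\qquad G^{f,m}=\mathrm{Ric}^{f,m}-\tfrac12 R^{f,m}g ,$$ where $\square_g f=\mathrm{tr}_g\,\mathrm{Hess} f$. Let $N=M\times S$ carry the warped product metric $\gamma=g\oplus e^{-2f/m}h$. Fix $(q,r)\in N$, let $U,V\in T_qM$ be future-causal, and let $\iota_*U,\iota_*V\in T_{(q,r)}N$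 be their images under the differential of the inclusion $\iota:M\to N$, $x\mapsto(x,r)$. (i) If $G^{f,m}(M,g)(U,V)\ge 0$ at $q$ and $R(S,h)\ge 0$ at $r$, then $G(N,\gamma)(\iota_*U,\iota_*V)\ge 0$. (ii) If $G(N,\gamma)(\iota_*U,\iota_*V)\ge 0$ and $R(S,h)\le 0$ at $r$, then $G^{f,m}(M,g)(U,V)\ge 0$ at $q$. -/

import Mathlib

set_option maxSynthPendingDepth 3

open scoped Manifold ContDiff Bundle

noncomputable section

/-! ### Pseudo-Riemannian tensor calculus on a coordinate domain

`E` is the (finite-dimensional) coordinate space and `G : E → E →L[ℝ] E →L[ℝ] ℝ` is a field of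
bilinear forms on it, `G y u v` being the value of the metric at the point `y` on the coordinate
vectors `u`, `v`. The formulas are meant at the points near which `G` is `C²`, symmetric and
nondegenerate. -/

namespace CoordGeom

variable {E : Type*} [NormedAddCommGroup E] [NormedSpace ℝ E]

/-- Cyclic permutation `(u, v, w) ↦ D(w, u, v)` of the arguments of a trilinear form. -/
def rotate (D : E →L[ℝ] E →L[ℝ] E →L[ℝ] ℝ) : E →L[ℝ] E →L[ℝ] E →L[ℝ] ℝ :=
  (ContinuousLinearMap.flipₗᵢ ℝ E E ℝ : (E →L[ℝ] E →L[ℝ] ℝ) →L[ℝ] (E →L[ℝ] E →L[ℝ] ℝ)) ∘L D.flip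

/-- The derivative of a field of bilinear forms, as the trilinear form `(u, v, w) ↦ ∂_u G(v, w)`. -/
def dMetric (G : E → E →L[ℝ] E →L[ℝ] ℝ) (y : E) : E →L[ℝ] E →L[ℝ] E →L[ℝ] ℝ := fderiv ℝ G y

/-- Christoffel symbols of the first kind:
`Γ(u, v; w) = ½ (∂_u G(v, w) + ∂_v G(u, w) - ∂_w G(u, v))`, see `christoffelFirst_apply`. -/
def christoffelFirst (G : E → E →L[ℝ] E →L[ℝ] ℝ) (y : E) : E →L[ℝ] E →L[ℝ] E →L[ℝ] ℝ :=
  (2⁻¹ : ℝ) • (dMetric G y + (dMetric G y).flip - rotate (dMetric G y))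

theorem christoffelFirst_apply (G : E → E →L[ℝ] E →L[ℝ] ℝ) (y u v w : E) :
    christoffelFirst G y u v w =
      2⁻¹ * (fderiv ℝ G y u v w + fderiv ℝ G y v u w - fderiv ℝ G y w u v) := rfl

/-- Raising an index: for a nondegenerate form `B`, the vector `sharp B α` is the unique one with
`B (sharp B α) w = α w` for all `w`. -/
def sharp (B : E →L[ℝ] E →L[ℝ] ℝ) : (E →L[ℝ] ℝ) →L[ℝ] E := B.inverse

/-- Christoffel symbols `Γ(u, v)` (of the second kind) of the Levi-Civita connection of `G`, so
that `∇_u Y = ∂_u Y + Γ(u, Y)` in coordinates. -/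
def christoffel (G : E → E →L[ℝ] E →L[ℝ] ℝ) (y : E) : E →L[ℝ] E →L[ℝ] E :=
  ContinuousLinearMap.compL ℝ E (E →L[ℝ] ℝ) E (sharp (G y)) ∘L christoffelFirst G y

theorem christoffel_apply (G : E → E →L[ℝ] E →L[ℝ] ℝ) (y u v : E) :
    christoffel G y u v = sharp (G y) (christoffelFirst G y u v) := rfl

/-- The derivative `(u, v, w) ↦ ∂_u Γ(v, w)` of the Christoffel symbols. -/
def dChristoffel (G : E → E →L[ℝ] E →L[ℝ] ℝ) (y : E) : E →L[ℝ] E →L[ℝ] E →L[ℝ] E :=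
  fderiv ℝ (christoffel G) y

/-- The Riemann tensor, as the endomorphism `u ↦ R(u, v) w` with the convention
`R(X, Y) Z = ∇_X ∇_Y Z - ∇_Y ∇_X Z - ∇_[X,Y] Z`, see `riemann_apply`. -/
def riemann (G : E → E →L[ℝ] E →L[ℝ] ℝ) (y v w : E) : E →L[ℝ] E :=
  ((dChristoffel G y).flip v).flip w - (dChristoffel G y v).flip w
    + (christoffel G y).flip (christoffel G y v w) - christoffel G y v ∘L (christoffel G y).flip w

theorem riemann_apply (G : E → E →L[ℝ] E →L[ℝ] ℝ) (y u v w : E) :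
    riemann G y v w u =
      dChristoffel G y u v w - dChristoffel G y v u w
        + christoffel G y u (christoffel G y v w) - christoffel G y v (christoffel G y u w) := rfl

/-- The Ricci tensor `Ric(v, w) = tr (u ↦ R(u, v) w)`. -/
def ricci (G : E → E →L[ℝ] E →L[ℝ] ℝ) (y : E) : LinearMap.BilinForm ℝ E :=
  LinearMap.mk₂ ℝ (fun v w => LinearMap.trace ℝ E (riemann G y v w).toLinearMap)
    (fun v₁ v₂ w => by
      rw [← map_add]; congr 1; ext u
      simp only [ContinuousLinearMap.coe_coe, LinearMap.add_apply, riemann_apply, map_add,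
        _root_.add_apply]
      abel)
    (fun c v w => by
      rw [← map_smul]; congr 1; ext u
      simp only [ContinuousLinearMap.coe_coe, LinearMap.smul_apply, riemann_apply, map_smul,
        _root_.smul_apply, smul_sub, smul_add])
    (fun v w₁ w₂ => by
      rw [← map_add]; congr 1; ext u
      simp only [ContinuousLinearMap.coe_coe, LinearMap.add_apply, riemann_apply, map_add]
      abel)
    (fun c v w => by
      rw [← map_smul]; congr 1; ext u
      simp only [ContinuousLinearMap.coe_coe, LinearMap.smul_apply, riemann_apply, map_smul,
        smul_sub, smul_add])

theorem ricci_apply (G : E → E →L[ℝ] E →L[ℝ] ℝ) (y v w : E) :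
    ricci G y v w = LinearMap.trace ℝ E (riemann G y v w).toLinearMap := rfl

/-- The Hessian `Hess φ (u, v) = ∂_u ∂_v φ - dφ(Γ(u, v))` of a function, see `hess_apply`. -/
def hess (G : E → E →L[ℝ] E →L[ℝ] ℝ) (φ : E → ℝ) (y : E) : LinearMap.BilinForm ℝ E :=
  (fderiv ℝ (fderiv ℝ φ) y
    - ContinuousLinearMap.compL ℝ E E ℝ (fderiv ℝ φ y) ∘L christoffel G y).toLinearMap₁₂

theorem hess_apply (G : E → E →L[ℝ] E →L[ℝ] ℝ) (φ : E → ℝ) (y u v : E) :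
    hess G φ y u v = fderiv ℝ (fderiv ℝ φ) y u v - fderiv ℝ φ y (christoffel G y u v) := rfl

/-- The squared norm `|∇φ|² = dφ(∇φ)` of the gradient `∇φ = sharp (dφ)`; it may be negative when
`G` is indefinite. -/
def gradSq (G : E → E →L[ℝ] E →L[ℝ] ℝ) (φ : E → ℝ) (y : E) : ℝ :=
  fderiv ℝ φ y (sharp (G y) (fderiv ℝ φ y))

variable [FiniteDimensional ℝ E]

/-- The trace `B^{ij} T_{ij}` of a bilinear form `T` with respect to a nondegenerate form `B`,
that is, the trace of the endomorphism obtained from `T` by raising an index with `B`. -/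
def gtrace (B : E →L[ℝ] E →L[ℝ] ℝ) (T : LinearMap.BilinForm ℝ E) : ℝ :=
  LinearMap.trace ℝ E
    ((sharp B).toLinearMap ∘ₗ LinearMap.toContinuousLinearMap.toLinearMap ∘ₗ T)

/-- The scalar curvature `G^{ij} Ric_{ij}`. -/
def scalar (G : E → E →L[ℝ] E →L[ℝ] ℝ) (y : E) : ℝ := gtrace (G y) (ricci G y)

/-- The trace of the Hessian: the Laplacian, or d'Alembertian in Lorentzian signature. -/
def box (G : E → E →L[ℝ] E →L[ℝ] ℝ) (φ : E → ℝ) (y : E) : ℝ := gtrace (G y) (hess G φ y)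

end CoordGeom

/-! ### Tensors on manifolds -/

section Manifolds

variable {E : Type*} [NormedAddCommGroup E] [NormedSpace ℝ E]
  {H : Type*} [TopologicalSpace H] {I : ModelWithCorners ℝ E H}
  {M : Type*} [TopologicalSpace M] [ChartedSpace H M]

variable (I M) in
/-- Fields of bilinear forms on the tangent spaces of `M`. -/
abbrev TwoTensor : Type _ :=
  ∀ x : M, TangentSpace I x →L[ℝ] TangentSpace I x →L[ℝ] ℝ

variable (I M) in
/-- A smooth Lorentzian metric, of signature `(-, +, …, +)`: at each point there is a timelike
vector whose orthogonal complement is positive definite. -/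
structure LorentzMetric [IsManifold I ∞ M] where
  /-- The metric tensor. -/
  val : TwoTensor I M
  symm : ∀ (x : M) (u v : TangentSpace I x), val x u v = val x v u
  signature : ∀ x : M, ∃ t : TangentSpace I x, val x t t < 0 ∧
    ∀ v : TangentSpace I x, val x t v = 0 → v ≠ 0 → 0 < val x v v
  contMDiff : ContMDiff I (I.prod 𝓘(ℝ, E →L[ℝ] E →L[ℝ] ℝ)) ∞
    (fun x => Bundle.TotalSpace.mk' (E →L[ℝ] E →L[ℝ] ℝ)
      (E := fun x : M => TangentSpace I x →L[ℝ] TangentSpace I x →L[ℝ] ℝ) x (val x))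

/-- A time orientation: a continuous timelike vector field, declared to point to the future. -/
structure TimeOrientation [IsManifold I ∞ M] (g : LorentzMetric I M) where
  /-- The vector field. -/
  field : ∀ x : M, TangentSpace I x
  timelike : ∀ x : M, g.val x (field x) (field x) < 0
  continuous : Continuous (fun x : M => (⟨x, field x⟩ : TangentBundle I M))

/-- Future-causal vectors: nonzero vectors that are timelike or null and lie in the same half of
the causal cone as the time orientation. -/
def TimeOrientation.IsFutureCausal [IsManifold I ∞ M] {g : LorentzMetric I M}
    (T : TimeOrientation g) {x : M} (v : TangentSpace I x) : Prop :=
  v ≠ 0 ∧ g.val x v v ≤ 0 ∧ g.val x (T.field x) v < 0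

namespace Geom

variable (I) in
/-- The differential at `y` of the inverse of the preferred chart at `p`; it sends a coordinate
vector `u` to the tangent vector `uⁱ ∂ᵢ`. -/
def coordFrame (p : M) (y : E) : E →L[ℝ] TangentSpace I ((extChartAt I p).symm y) :=
  mfderiv 𝓘(ℝ, E) I (extChartAt I p).symm y

variable (I) in
/-- The differential at `p` of the preferred chart at `p`; it sends a tangent vector to its vector
of coordinates. -/
def toCoord (p : M) : TangentSpace I p →L[ℝ] E :=
  mfderiv I 𝓘(ℝ, E) (extChartAt I p) p

/-- The coordinate components `g_{ij}(y)` of a two-tensor in the preferred chart at `p`, see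
`coordMetric_apply`. -/
def coordMetric (g : TwoTensor I M) (p : M) (y : E) : E →L[ℝ] E →L[ℝ] ℝ :=
  ContinuousLinearMap.precomp ℝ (coordFrame I p y) ∘L
    g ((extChartAt I p).symm y) ∘L coordFrame I p y

theorem coordMetric_apply (g : TwoTensor I M) (p : M) (y u v : E) :
    coordMetric g p y u v =
      g ((extChartAt I p).symm y) (coordFrame I p y u) (coordFrame I p y v) := rfl

/-- A function in the preferred chart at `p`. -/
def coordFun (f : M → ℝ) (p : M) (y : E) : ℝ := f ((extChartAt I p).symm y)

/-! The tensors below are computed at `p` in the preferred chart at `p`. As they are tensors, any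
other chart of the smooth atlas gives the same values. Manifolds are without boundary. -/

/-- The Ricci tensor of `g` at `p`. -/
def ricci (g : TwoTensor I M) (p : M) (u v : TangentSpace I p) : ℝ :=
  CoordGeom.ricci (coordMetric g p) (extChartAt I p p) (toCoord I p u) (toCoord I p v)

/-- The Hessian of `f` at `p`, for the Levi-Civita connection of `g`. -/
def hess (g : TwoTensor I M) (f : M → ℝ) (p : M) (u v : TangentSpace I p) : ℝ :=
  CoordGeom.hess (coordMetric g p) (coordFun (I := I) f p) (extChartAt I p p)
    (toCoord I p u) (toCoord I p v)

/-- The squared norm `|∇f|²` of the gradient of `f`. -/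
def gradSq (g : TwoTensor I M) (f : M → ℝ) (p : M) : ℝ :=
  CoordGeom.gradSq (coordMetric g p) (coordFun (I := I) f p) (extChartAt I p p)

variable [FiniteDimensional ℝ E]

/-- The scalar curvature of `g` at `p`. -/
def scalar (g : TwoTensor I M) (p : M) : ℝ :=
  CoordGeom.scalar (coordMetric g p) (extChartAt I p p)

/-- The trace of the Hessian of `f` at `p`. -/
def box (g : TwoTensor I M) (f : M → ℝ) (p : M) : ℝ :=
  CoordGeom.box (coordMetric g p) (coordFun (I := I) f p) (extChartAt I p p)

/-- The Einstein tensor `Ric - ½ R g`. -/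
def einstein (g : TwoTensor I M) (p : M) (u v : TangentSpace I p) : ℝ :=
  ricci g p u v - 1 / 2 * scalar g p * g p u v

/-- The differential `df` of a function at `p`. -/
def differential (f : M → ℝ) (p : M) : TangentSpace I p →L[ℝ] ℝ := mfderiv I 𝓘(ℝ, ℝ) f p

/-- The `m`-Bakry–Émery Ricci tensor `Ric + Hess f - (1/m) df ⊗ df`. -/
def ricciBE (g : TwoTensor I M) (f : M → ℝ) (m : ℝ) (p : M) (u v : TangentSpace I p) : ℝ :=
  ricci g p u v + hess g f p u v - 1 / m * (differential f p u * differential f p v)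

/-- The `m`-Bakry–Émery scalar curvature `R + 2 □f - ((m+1)/m) |∇f|²`. -/
def scalarBE (g : TwoTensor I M) (f : M → ℝ) (m : ℝ) (p : M) : ℝ :=
  scalar g p + 2 * box g f p - (m + 1) / m * gradSq g f p

/-- The `m`-Bakry–Émery Einstein tensor `Ric^{f,m} - ½ R^{f,m} g`. -/
def einsteinBE (g : TwoTensor I M) (f : M → ℝ) (m : ℝ) (p : M) (u v : TangentSpace I p) : ℝ :=
  ricciBE g f m p u v - 1 / 2 * scalarBE g f m p * g p u v

end Geom

/-! ### Warped products -/

variable {F : Type*} [NormedAddCommGroup F] [NormedSpace ℝ F]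
  {K : Type*} [TopologicalSpace K] {J : ModelWithCorners ℝ F K}
  {S : Type*} [TopologicalSpace S] [ChartedSpace K S]

namespace Geom

variable (I J) in
/-- The differential of the projection `M × S → M`. -/
def dfst (p : M × S) : TangentSpace (I.prod J) p →L[ℝ] TangentSpace I p.1 :=
  mfderiv (I.prod J) I Prod.fst p

variable (I J) in
/-- The differential of the projection `M × S → S`. -/
def dsnd (p : M × S) : TangentSpace (I.prod J) p →L[ℝ] TangentSpace J p.2 :=
  mfderiv (I.prod J) J Prod.snd p

/-- The warped product metric `g ⊕ e^{-2f/m} h` on `M × S`, see `warpedMetric_apply`. -/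
def warpedMetric (g : TwoTensor I M) (h : TwoTensor J S) (f : M → ℝ) (m : ℝ) :
    TwoTensor (I.prod J) (M × S) := fun p =>
  ContinuousLinearMap.precomp ℝ (dfst I J p) ∘L g p.1 ∘L dfst I J p
    + Real.exp (-2 * f p.1 / m) •
      (ContinuousLinearMap.precomp ℝ (dsnd I J p) ∘L h p.2 ∘L dsnd I J p)

theorem warpedMetric_apply (g : TwoTensor I M) (h : TwoTensor J S) (f : M → ℝ) (m : ℝ)
    (p : M × S) (u v : TangentSpace (I.prod J) p) :
    warpedMetric g h f m p u v =
      g p.1 (dfst I J p u) (dfst I J p v)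
        + Real.exp (-2 * f p.1 / m) * h p.2 (dsnd I J p u) (dsnd I J p v) := rfl

variable (I J) in
/-- The push-forward `ι_* : T_q M → T_{(q,r)} (M × S)` under the inclusion `ι : x ↦ (x, r)`. -/
def pushBase (q : M) (r : S) : TangentSpace I q →L[ℝ] TangentSpace (I.prod J) (q, r) :=
  mfderiv I (I.prod J) (fun x : M => (x, r)) q

end Geom

end Manifolds

end

/-! Put $\varphi=-f/m$, so that $\gamma=g\oplus e^{2\varphi}h$ with fibre dimension $m$. The
classical warped product formulas then say that the Ricci tensor of $\gamma$ in base directions is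
exactly $\mathrm{Ric}^{f,m}$, and that its scalar curvature is $R^{f,m}+e^{2f/m}R(S,h)$. Hence
$G(N,\gamma)(\iota_*U,\iota_*V)=G^{f,m}(U,V)-\tfrac12 e^{2f/m}R(S,h)\,g(U,V)$. Two future-causal
vectors satisfy $g(U,V)\le 0$, so the correction term has the sign of $R(S,h)$, which gives both
implications.

The curvature formulas are `CoordGeom.ricci_warp_base` and `CoordGeom.scalar_warp`, proved on a
coordinate domain from the Christoffel symbols. `Geom.coordMetric_warpedMetric` carries them to
manifolds, `Geom.einstein_warpedMetric` is the displayed identity, and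
`LinearMap.BilinForm.nonpos_of_causal` gives the sign. -/

noncomputable section

open scoped Topology
open Filter

namespace CoordGeom

/-! ### Metrics near a point, gradients and Hessians in coordinates. -/

section Basic

variable {E : Type*} [NormedAddCommGroup E] [NormedSpace ℝ E]

/-- `G` is a `C²` symmetric nondegenerate field of bilinear forms near `y`. -/
structure IsMetricAt (G : E → E →L[ℝ] E →L[ℝ] ℝ) (y : E) : Prop where
  contDiffAt : ContDiffAt ℝ 2 G y
  symm : ∀ᶠ z in 𝓝 y, ∀ u v, G z u v = G z v u
  inv : (G y).IsInvertible

theorem apply_sharp {B : E →L[ℝ] E →L[ℝ] ℝ} (hB : B.IsInvertible) (α : E →L[ℝ] ℝ) :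
    B (sharp B α) = α := hB.self_apply_inverse α

theorem sharp_eq_iff {B : E →L[ℝ] E →L[ℝ] ℝ} (hB : B.IsInvertible) {α : E →L[ℝ] ℝ} {x : E} :
    sharp B α = x ↔ ∀ w, B x w = α w := by
  rw [← hB.injective.eq_iff, apply_sharp hB, eq_comm, ContinuousLinearMap.ext_iff]

theorem sharp_apply {B : E →L[ℝ] E →L[ℝ] ℝ} (hB : B.IsInvertible) (x : E) :
    sharp B (B x) = x := hB.inverse_apply_self x

theorem _root_.ContinuousLinearMap.IsInvertible.eventually {X : Type*} [NormedAddCommGroup X]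
    [NormedSpace ℝ X] [CompleteSpace E] {B : E →L[ℝ] X} (hB : B.IsInvertible) :
    ∀ᶠ C in 𝓝 B, C.IsInvertible := by
  obtain ⟨e, rfl⟩ := hB
  filter_upwards [ContinuousLinearEquiv.nhds e] with C hC
  obtain ⟨e', rfl⟩ := hC
  exact ⟨e', rfl⟩

variable {G G' : E → E →L[ℝ] E →L[ℝ] ℝ} {φ φ' : E → ℝ} {y : E}

/-- Curvature sees only the germ of the metric. This suffices because the chart description of the
warped metric is available only near the point. -/
theorem christoffel_congr (h : G =ᶠ[𝓝 y] G') : christoffel G =ᶠ[𝓝 y] christoffel G' := by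
  filter_upwards [h.eventuallyEq_nhds] with z hz
  simp only [christoffel, christoffelFirst, dMetric, hz.fderiv_eq, hz.eq_of_nhds]

theorem riemann_congr (h : G =ᶠ[𝓝 y] G') : riemann G y = riemann G' y := by
  have h1 := christoffel_congr h
  funext v w
  simp only [riemann, dChristoffel, h1.fderiv_eq, h1.eq_of_nhds]

theorem ricci_congr (h : G =ᶠ[𝓝 y] G') : ricci G y = ricci G' y := by
  ext v w
  simp only [ricci_apply, riemann_congr h]

theorem scalar_congr [FiniteDimensional ℝ E] (h : G =ᶠ[𝓝 y] G') : scalar G y = scalar G' y := by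
  simp only [scalar, ricci_congr h, h.eq_of_nhds]

theorem IsMetricAt.eventually [CompleteSpace E] (h : IsMetricAt G y) :
    ∀ᶠ z in 𝓝 y, IsMetricAt G z := by
  filter_upwards [h.contDiffAt.eventually (by simp), h.symm.eventually_nhds,
    h.contDiffAt.continuousAt.eventually h.inv.eventually] with z h1 h2 h3
  exact ⟨h1, h2, h3⟩

theorem IsMetricAt.differentiableAt (h : IsMetricAt G y) : DifferentiableAt ℝ G y :=
  h.contDiffAt.differentiableAt (by simp)

theorem IsMetricAt.differentiableAt_fderiv (h : IsMetricAt G y) :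
    DifferentiableAt ℝ (fderiv ℝ G) y :=
  (h.contDiffAt.fderiv_right (m := 1) le_rfl).differentiableAt (by simp)

theorem IsMetricAt.fderiv_symm (h : IsMetricAt G y) (u v w : E) :
    fderiv ℝ G y u v w = fderiv ℝ G y u w v := by
  have h1 : ∀ a b, fderiv ℝ (fun z => G z a b) y u = fderiv ℝ G y u a b := by
    intro a b
    have := ((h.differentiableAt.hasFDerivAt.clm_apply (hasFDerivAt_const a y)).clm_apply
      (hasFDerivAt_const b y)).fderiv
    rw [this]; simp
  rw [← h1, ← h1]
  have : (fun z => G z v w) =ᶠ[𝓝 y] fun z => G z w v := by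
    filter_upwards [h.symm] with z hz using hz v w
  rw [this.fderiv_eq]

theorem IsMetricAt.differentiableAt_sharp [CompleteSpace E] (h : IsMetricAt G y) :
    DifferentiableAt ℝ (fun z => sharp (G z)) y :=
  ((h.inv.contDiffAt_map_inverse (n := 1)).comp y
    (h.contDiffAt.of_le (by norm_num))).differentiableAt (by simp)

theorem IsMetricAt.differentiableAt_christoffel [CompleteSpace E] (h : IsMetricAt G y) :
    DifferentiableAt ℝ (christoffel G) y := by
  have h0 := h.differentiableAt_fderiv
  have h1 : DifferentiableAt ℝ (christoffelFirst G) y := by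
    unfold christoffelFirst dMetric rotate
    have h2 : DifferentiableAt ℝ (fun z => (fderiv ℝ G z).flip) y :=
      (ContinuousLinearMap.flipₗᵢ ℝ E E (E →L[ℝ] ℝ)).differentiableAt.comp y h0
    exact ((h0.add h2).sub ((differentiableAt_const
      ((ContinuousLinearMap.flipₗᵢ ℝ E E ℝ : (E →L[ℝ] E →L[ℝ] ℝ) →L[ℝ] (E →L[ℝ] E →L[ℝ] ℝ)))).clm_comp
      h2)).const_smul (2⁻¹ : ℝ)
  have h2 : DifferentiableAt ℝ
      (fun z => ContinuousLinearMap.compL ℝ E (E →L[ℝ] ℝ) E (sharp (G z))) y :=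
    (ContinuousLinearMap.compL ℝ E (E →L[ℝ] ℝ) E).differentiableAt.comp y h.differentiableAt_sharp
  exact h2.clm_comp h1

theorem IsMetricAt.apply_christoffel (h : IsMetricAt G y) (u v w : E) :
    G y (christoffel G y u v) w = christoffelFirst G y u v w := by
  rw [christoffel_apply, apply_sharp h.inv]

/-- The gradient of a function. -/
def grad (G : E → E →L[ℝ] E →L[ℝ] ℝ) (φ : E → ℝ) (y : E) : E := sharp (G y) (fderiv ℝ φ y)

theorem gradSq_eq (G : E → E →L[ℝ] E →L[ℝ] ℝ) (φ : E → ℝ) (y : E) :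
    gradSq G φ y = fderiv ℝ φ y (grad G φ y) := rfl

theorem IsMetricAt.apply_grad (h : IsMetricAt G y) (φ : E → ℝ) (w : E) :
    G y (grad G φ y) w = fderiv ℝ φ y w := by
  rw [grad, apply_sharp h.inv]

theorem differentiableAt_fderiv_of_contDiffAt (hφ : ContDiffAt ℝ 2 φ y) :
    DifferentiableAt ℝ (fderiv ℝ φ) y :=
  (hφ.fderiv_right (m := 1) le_rfl).differentiableAt (by simp)

theorem IsMetricAt.differentiableAt_grad [CompleteSpace E] (h : IsMetricAt G y)
    (hφ : ContDiffAt ℝ 2 φ y) : DifferentiableAt ℝ (grad G φ) y :=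
  h.differentiableAt_sharp.clm_apply (differentiableAt_fderiv_of_contDiffAt hφ)

theorem IsMetricAt.apply_fderiv_grad [CompleteSpace E] (h : IsMetricAt G y)
    (hφ : ContDiffAt ℝ 2 φ y) (u w : E) :
    G y (fderiv ℝ (grad G φ) y u) w =
      fderiv ℝ (fderiv ℝ φ) y u w - fderiv ℝ G y u (grad G φ y) w := by
  have h1 : (fun z => G z (grad G φ z)) =ᶠ[𝓝 y] fderiv ℝ φ := by
    filter_upwards [h.eventually] with z hz
    ext w
    exact hz.apply_grad φ w
  have h2 := (h.differentiableAt.hasFDerivAt.clm_apply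
    (h.differentiableAt_grad hφ).hasFDerivAt).fderiv
  rw [← h1.fderiv_eq, h2]
  simp

/-- Raising an index of the Hessian gives $\nabla_u\,\mathrm{grad}\,\varphi$: differentiate
$G(\mathrm{grad}\,\varphi)=d\varphi$ and absorb $\partial_uG$ into Christoffel symbols. -/
theorem IsMetricAt.sharp_hess [CompleteSpace E] (h : IsMetricAt G y)
    (hφ : ContDiffAt ℝ 2 φ y) (u : E) (α : E →L[ℝ] ℝ) (hα : ∀ w, α w = hess G φ y u w) :
    sharp (G y) α = fderiv ℝ (grad G φ) y u + christoffel G y u (grad G φ y) := by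
  rw [sharp_eq_iff h.inv]
  intro w
  rw [hα, hess_apply, map_add, add_apply, h.apply_fderiv_grad hφ, h.apply_christoffel,
    christoffelFirst_apply, ← h.apply_grad, h.symm.self_of_nhds, h.apply_christoffel,
    christoffelFirst_apply, h.fderiv_symm u w, h.fderiv_symm w u]
  ring

variable [FiniteDimensional ℝ E]

/-- The Laplacian as the divergence of the gradient, in the shape in which it appears in the Ricci
trace of a warped product. -/
theorem IsMetricAt.box_eq (h : IsMetricAt G y) (hφ : ContDiffAt ℝ 2 φ y) :
    box G φ y = LinearMap.trace ℝ E ((fderiv ℝ (grad G φ) y).toLinearMap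
      + ((christoffel G y).flip (grad G φ y)).toLinearMap) := by
  have : CompleteSpace E := FiniteDimensional.complete ℝ E
  rw [box, gtrace]
  congr 1
  ext u
  exact h.sharp_hess hφ u _ fun w => rfl

end Basic

/-! ### Dependence on constant factors, and traces of simple forms. -/

section Scaling

variable {E : Type*} [NormedAddCommGroup E] [NormedSpace ℝ E]
  {G : E → E →L[ℝ] E →L[ℝ] ℝ} {φ : E → ℝ} {y : E}

theorem fderiv_const_mul_apply (c : ℝ) (u : E) :
    fderiv ℝ (fun z => c * φ z) y u = c * fderiv ℝ φ y u := by
  have h1 : fderiv ℝ (fun z => c * φ z) = c • fderiv ℝ φ :=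
    fderiv_const_smul_field (f := φ) c
  rw [h1]
  rfl

theorem hess_const_mul (c : ℝ) (u v : E) :
    hess G (fun z => c * φ z) y u v = c * hess G φ y u v := by
  have h1 : fderiv ℝ (fun z => c * φ z) = c • fderiv ℝ φ :=
    fderiv_const_smul_field (f := φ) c
  rw [hess_apply, hess_apply, h1]
  rw [fderiv_const_smul_field]
  simp [mul_sub]

theorem gradSq_const_mul (c : ℝ) :
    gradSq G (fun z => c * φ z) y = c ^ 2 * gradSq G φ y := by
  have h1 : fderiv ℝ (fun z => c * φ z) = c • fderiv ℝ φ :=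
    fderiv_const_smul_field (f := φ) c
  rw [gradSq, gradSq, h1]
  simp
  ring

theorem gtrace_smul [FiniteDimensional ℝ E] (B : E →L[ℝ] E →L[ℝ] ℝ) (c : ℝ)
    (T : LinearMap.BilinForm ℝ E) : gtrace B (c • T) = c * gtrace B T := by
  rw [gtrace, gtrace, LinearMap.comp_smul, LinearMap.comp_smul, map_smul, smul_eq_mul]

theorem gtrace_add [FiniteDimensional ℝ E] (B : E →L[ℝ] E →L[ℝ] ℝ)
    (T T' : LinearMap.BilinForm ℝ E) : gtrace B (T + T') = gtrace B T + gtrace B T' := by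
  rw [gtrace, LinearMap.comp_add, LinearMap.comp_add, map_add, gtrace, gtrace]

theorem gtrace_self [FiniteDimensional ℝ E] {B : E →L[ℝ] E →L[ℝ] ℝ} (hB : B.IsInvertible)
    (T : LinearMap.BilinForm ℝ E) (hT : ∀ u v, T u v = B u v) :
    gtrace B T = Module.finrank ℝ E := by
  rw [gtrace, ← LinearMap.trace_id ℝ E]
  congr 1
  ext u
  exact (sharp_eq_iff hB).2 fun w => (hT u w).symm

/-- Raising an index of $\alpha\otimes\alpha$ gives the rank-one endomorphism
$u\mapsto\alpha(u)\,\alpha^\sharp$, whose trace is $\alpha(\alpha^\sharp)$. -/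
theorem gtrace_mul [FiniteDimensional ℝ E] (B : E →L[ℝ] E →L[ℝ] ℝ)
    (α : E →L[ℝ] ℝ) (T : LinearMap.BilinForm ℝ E) (hT : ∀ u v, T u v = α u * α v) :
    gtrace B T = α (sharp B α) := by
  have h := LinearMap.trace_smulRight (R := ℝ) (α : E →ₗ[ℝ] ℝ) (sharp B α)
  rw [gtrace, ← ContinuousLinearMap.coe_coe α, ← h]
  congr 1
  ext u
  have : LinearMap.toContinuousLinearMap (T u) = α u • α := by
    ext w; exact hT u w
  simp [this]

theorem box_const_mul [FiniteDimensional ℝ E] (c : ℝ) :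
    box G (fun z => c * φ z) y = c * box G φ y := by
  rw [box, box, ← gtrace_smul]
  congr 1
  ext u v
  exact hess_const_mul c u v

end Scaling

/-! ### Christoffel symbols of a warped product and their derivatives. -/

section Warp

variable {E : Type*} [NormedAddCommGroup E] [NormedSpace ℝ E]
  {F : Type*} [NormedAddCommGroup F] [NormedSpace ℝ F]
  {G : E → E →L[ℝ] E →L[ℝ] ℝ} {H : F → F →L[ℝ] F →L[ℝ] ℝ} {φ : E → ℝ} {p : E × F}

/-- The warped product `G ⊕ e^{2φ} H` of two fields of bilinear forms. -/
def warp (G : E → E →L[ℝ] E →L[ℝ] ℝ) (H : F → F →L[ℝ] F →L[ℝ] ℝ) (φ : E → ℝ) (p : E × F) :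
    E × F →L[ℝ] E × F →L[ℝ] ℝ :=
  ContinuousLinearMap.precomp ℝ (ContinuousLinearMap.fst ℝ E F) ∘L
      G p.1 ∘L ContinuousLinearMap.fst ℝ E F
    + Real.exp (2 * φ p.1) • (ContinuousLinearMap.precomp ℝ (ContinuousLinearMap.snd ℝ E F) ∘L
      H p.2 ∘L ContinuousLinearMap.snd ℝ E F)

theorem warp_apply (x y : E × F) :
    warp G H φ p x y = G p.1 x.1 y.1 + Real.exp (2 * φ p.1) * H p.2 x.2 y.2 := rfl

theorem dChristoffel_apply {y : E} (h : DifferentiableAt ℝ (christoffel G) y) (u v w : E) :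
    dChristoffel G y u v w = fderiv ℝ (fun z => christoffel G z v w) y u := by
  rw [dChristoffel, ((h.hasFDerivAt.clm_apply (hasFDerivAt_const v y)).clm_apply
    (hasFDerivAt_const w y)).fderiv]
  simp

theorem hasFDerivAt_clm_apply₂ {X Y Z : Type*} [NormedAddCommGroup X] [NormedSpace ℝ X]
    [NormedAddCommGroup Y] [NormedSpace ℝ Y] [NormedAddCommGroup Z] [NormedSpace ℝ Z]
    {B : X → Y →L[ℝ] Y →L[ℝ] Z} {x : X} (h : DifferentiableAt ℝ B x) (v w : Y) :
    HasFDerivAt (fun z => B z v w) (((fderiv ℝ B x).flip v).flip w) x := by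
  have := (h.hasFDerivAt.clm_apply (hasFDerivAt_const v x)).clm_apply (hasFDerivAt_const w x)
  convert this using 1
  ext u
  simp

theorem contDiffAt_warp (hG : ContDiffAt ℝ 2 G p.1) (hH : ContDiffAt ℝ 2 H p.2)
    (hφ : ContDiffAt ℝ 2 φ p.1) : ContDiffAt ℝ 2 (warp G H φ) p := by
  have h1 : ContDiffAt ℝ 2 (fun p : E × F => G p.1) p := hG.comp p contDiffAt_fst
  have h2 : ContDiffAt ℝ 2 (fun p : E × F => H p.2) p := hH.comp p contDiffAt_snd
  have h3 : ContDiffAt ℝ 2 (fun p : E × F => φ p.1) p := hφ.comp p contDiffAt_fst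
  exact (contDiffAt_const.clm_comp (h1.clm_comp contDiffAt_const)).add
    ((contDiffAt_const.mul h3).exp.smul (contDiffAt_const.clm_comp (h2.clm_comp contDiffAt_const)))

theorem isInvertible_warp (hG : (G p.1).IsInvertible) (hH : (H p.2).IsInvertible) :
    (warp G H φ p).IsInvertible := by
  -- The form is block diagonal, so its inverse is too, with the factor $e^{-2\varphi}$ on the fibre
  -- block.
  refine .of_inverse (g := (ContinuousLinearMap.inl ℝ E F ∘L sharp (G p.1) ∘L
      ContinuousLinearMap.precomp ℝ (ContinuousLinearMap.inl ℝ E F)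
    + Real.exp (-(2 * φ p.1)) • (ContinuousLinearMap.inr ℝ E F ∘L sharp (H p.2) ∘L
      ContinuousLinearMap.precomp ℝ (ContinuousLinearMap.inr ℝ E F)))) ?_ ?_
  · refine ContinuousLinearMap.ext fun α => ContinuousLinearMap.ext fun x => ?_
    simp [warp_apply, apply_sharp hG, apply_sharp hH, ← mul_assoc, ← Real.exp_add, ← map_add]
  · have h1 : ∀ x, ContinuousLinearMap.precomp ℝ (ContinuousLinearMap.inl ℝ E F)
        (warp G H φ p x) = G p.1 x.1 := by
      intro x; ext u; simp [warp_apply]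
    have h2 : ∀ x, ContinuousLinearMap.precomp ℝ (ContinuousLinearMap.inr ℝ E F)
        (warp G H φ p x) = Real.exp (2 * φ p.1) • H p.2 x.2 := by
      intro x; ext u; simp [warp_apply]
    refine ContinuousLinearMap.ext fun x => ?_
    simp only [ContinuousLinearMap.comp_apply, add_apply, smul_apply, h1, h2, map_smul,
      sharp_apply hG, sharp_apply hH, smul_smul, ← Real.exp_add]
    simp

theorem IsMetricAt.warp (hG : IsMetricAt G p.1) (hH : IsMetricAt H p.2)
    (hφ : ContDiffAt ℝ 2 φ p.1) : IsMetricAt (warp G H φ) p where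
  contDiffAt := contDiffAt_warp hG.contDiffAt hH.contDiffAt hφ
  symm := by
    filter_upwards [continuousAt_fst.eventually hG.symm, continuousAt_snd.eventually hH.symm]
      with z h1 h2 x y
    rw [warp_apply, warp_apply, h1, h2]
  inv := isInvertible_warp hG.inv hH.inv

theorem fderiv_warp (hG : IsMetricAt G p.1) (hH : IsMetricAt H p.2)
    (hφ : ContDiffAt ℝ 2 φ p.1) (x y z : E × F) :
    fderiv ℝ (CoordGeom.warp G H φ) p x y z = fderiv ℝ G p.1 x.1 y.1 z.1
      + Real.exp (2 * φ p.1) *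
        (2 * fderiv ℝ φ p.1 x.1 * H p.2 y.2 z.2 + fderiv ℝ H p.2 x.2 y.2 z.2) := by
  have h0 := (hasFDerivAt_clm_apply₂ (hG.warp hH hφ).differentiableAt y z).fderiv
  have h1 := (hasFDerivAt_clm_apply₂ hG.differentiableAt y.1 z.1).comp p hasFDerivAt_fst
  have h2 := (hasFDerivAt_clm_apply₂ hH.differentiableAt y.2 z.2).comp p hasFDerivAt_snd
  have h3 := ((hφ.differentiableAt (by simp)).hasFDerivAt.comp p hasFDerivAt_fst)
  have h4 := (h1.add ((h3.const_mul 2).exp.mul h2)).fderiv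
  have h5 := congrArg (fun L => L x) (h0.symm.trans h4)
  simp only [ContinuousLinearMap.flip_apply] at h5
  rw [h5]
  simp
  ring

/-- It is enough to pair the right side with every $w$ and compare with the symbols of the first
kind. The gradient term comes from differentiating $e^{2\varphi}$ along $w$, the two $d\varphi$
terms from differentiating it along $x$ and $y$. -/
theorem christoffel_warp (hG : IsMetricAt G p.1) (hH : IsMetricAt H p.2)
    (hφ : ContDiffAt ℝ 2 φ p.1) (x y : E × F) :
    christoffel (CoordGeom.warp G H φ) p x y =
      (christoffel G p.1 x.1 y.1 - (Real.exp (2 * φ p.1) * H p.2 x.2 y.2) • grad G φ p.1,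
        christoffel H p.2 x.2 y.2 + fderiv ℝ φ p.1 x.1 • y.2 + fderiv ℝ φ p.1 y.1 • x.2) := by
  rw [christoffel_apply, sharp_eq_iff (hG.warp hH hφ).inv]
  intro w
  rw [warp_apply, christoffelFirst_apply]
  simp only [fderiv_warp hG hH hφ, map_sub, map_add, map_smul, _root_.sub_apply, _root_.add_apply,
    _root_.smul_apply, hG.apply_christoffel, hH.apply_christoffel, christoffelFirst_apply,
    hG.apply_grad, smul_eq_mul]
  ring

variable [CompleteSpace E] [CompleteSpace F]

theorem dChristoffel_warp (hG : IsMetricAt G p.1) (hH : IsMetricAt H p.2)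
    (hφ : ContDiffAt ℝ 2 φ p.1) (x y z : E × F) :
    dChristoffel (CoordGeom.warp G H φ) p x y z =
      (dChristoffel G p.1 x.1 y.1 z.1
          - (Real.exp (2 * φ p.1) *
            (2 * fderiv ℝ φ p.1 x.1 * H p.2 y.2 z.2 + fderiv ℝ H p.2 x.2 y.2 z.2)) • grad G φ p.1
          - (Real.exp (2 * φ p.1) * H p.2 y.2 z.2) • fderiv ℝ (grad G φ) p.1 x.1,
        dChristoffel H p.2 x.2 y.2 z.2 + fderiv ℝ (fderiv ℝ φ) p.1 x.1 y.1 • z.2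
          + fderiv ℝ (fderiv ℝ φ) p.1 x.1 z.1 • y.2) := by
  rw [dChristoffel_apply (hG.warp hH hφ).differentiableAt_christoffel]
  -- The closed formula holds at all nearby points, hence may be differentiated.
  have h0 : (fun p => christoffel (CoordGeom.warp G H φ) p y z) =ᶠ[𝓝 p] fun p =>
      (christoffel G p.1 y.1 z.1 - (Real.exp (2 * φ p.1) * H p.2 y.2 z.2) • grad G φ p.1,
        christoffel H p.2 y.2 z.2 + fderiv ℝ φ p.1 y.1 • z.2 + fderiv ℝ φ p.1 z.1 • y.2) := by
    filter_upwards [continuousAt_fst.eventually hG.eventually,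
      continuousAt_snd.eventually hH.eventually,
      continuousAt_fst.eventually (hφ.eventually (by simp))] with p' h1 h2 h3
    exact christoffel_warp h1 h2 h3 y z
  rw [h0.fderiv_eq]
  have h1 := (hasFDerivAt_clm_apply₂ hG.differentiableAt_christoffel y.1 z.1).comp p
    hasFDerivAt_fst
  have h2 := (hasFDerivAt_clm_apply₂ hH.differentiableAt y.2 z.2).comp p hasFDerivAt_snd
  have h3 := ((hφ.differentiableAt (by simp)).hasFDerivAt.comp p hasFDerivAt_fst)
  have h4 := (hG.differentiableAt_grad hφ).hasFDerivAt.comp p hasFDerivAt_fst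
  have h5 := (hasFDerivAt_clm_apply₂ hH.differentiableAt_christoffel y.2 z.2).comp p
    hasFDerivAt_snd
  have h6 := (differentiableAt_fderiv_of_contDiffAt hφ).hasFDerivAt.comp p hasFDerivAt_fst
  have h7 := ((h1.sub (((h3.const_mul 2).exp.mul h2).smul h4)).prodMk
    ((h5.add ((h6.clm_apply (hasFDerivAt_const y.1 p)).smul_const z.2)).add
      ((h6.clm_apply (hasFDerivAt_const z.1 p)).smul_const y.2))).fderiv
  refine (congrArg (fun L => L x) h7).trans ?_
  refine Prod.ext ?_ ?_
  · simp [dChristoffel]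
    module
  · simp [dChristoffel]

end Warp

/-! ### Trace of an endomorphism of a product. -/

section Trace

variable {E : Type*} [AddCommGroup E] [Module ℝ E] [FiniteDimensional ℝ E]
  {F : Type*} [AddCommGroup F] [Module ℝ F] [FiniteDimensional ℝ F]

/-- Only the diagonal blocks enter, so the mixed components of the curvature never have to be
computed. -/
theorem _root_.LinearMap.trace_prod_eq (A : E × F →ₗ[ℝ] E × F) (AE : E →ₗ[ℝ] E) (AF : F →ₗ[ℝ] F)
    (hE : ∀ u, (A (u, 0)).1 = AE u) (hF : ∀ a, (A (0, a)).2 = AF a) :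
    LinearMap.trace ℝ (E × F) A = LinearMap.trace ℝ E AE + LinearMap.trace ℝ F AF := by
  have h1 : A = (A ∘ₗ LinearMap.inl ℝ E F) ∘ₗ LinearMap.fst ℝ E F
      + (A ∘ₗ LinearMap.inr ℝ E F) ∘ₗ LinearMap.snd ℝ E F := by
    refine LinearMap.ext fun x => ?_
    simp [← map_add]
  have h2 : LinearMap.fst ℝ E F ∘ₗ (A ∘ₗ LinearMap.inl ℝ E F) = AE := LinearMap.ext hE
  have h3 : LinearMap.snd ℝ E F ∘ₗ (A ∘ₗ LinearMap.inr ℝ E F) = AF := LinearMap.ext hF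
  rw [h1, map_add, LinearMap.trace_comp_comm', h2, LinearMap.trace_comp_comm', h3]

end Trace

/-! ### Ricci and scalar curvature of a warped product. -/

section WarpCurvature

variable {E : Type*} [NormedAddCommGroup E] [NormedSpace ℝ E] [FiniteDimensional ℝ E]
  {F : Type*} [NormedAddCommGroup F] [NormedSpace ℝ F] [FiniteDimensional ℝ F]
  {G : E → E →L[ℝ] E →L[ℝ] ℝ} {H : F → F →L[ℝ] F →L[ℝ] ℝ} {φ : E → ℝ} {p : E × F}

theorem gtrace_warp (hG : (G p.1).IsInvertible) (hH : (H p.2).IsInvertible)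
    (T : LinearMap.BilinForm ℝ (E × F)) (TE : LinearMap.BilinForm ℝ E)
    (TF : LinearMap.BilinForm ℝ F) (hE : ∀ u v, T (u, 0) (v, 0) = TE u v)
    (hF : ∀ a b, T (0, a) (0, b) = TF a b) :
    gtrace (CoordGeom.warp G H φ p) T =
      gtrace (G p.1) TE + Real.exp (-(2 * φ p.1)) * gtrace (H p.2) TF := by
  have hW : (CoordGeom.warp G H φ p).IsInvertible := isInvertible_warp hG hH
  have h1 : ∀ (α : E × F →L[ℝ] ℝ) (αE : E →L[ℝ] ℝ), (∀ v, α (v, 0) = αE v) →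
      (sharp (CoordGeom.warp G H φ p) α).1 = sharp (G p.1) αE := by
    intro α αE h
    rw [eq_comm, sharp_eq_iff hG]
    intro v
    rw [← h, ← apply_sharp hW α, warp_apply, sharp_apply hW]
    simp
  have h2 : ∀ (α : E × F →L[ℝ] ℝ) (αF : F →L[ℝ] ℝ), (∀ v, α (0, v) = αF v) →
      (sharp (CoordGeom.warp G H φ p) α).2 = Real.exp (-(2 * φ p.1)) • sharp (H p.2) αF := by
    intro α αF h
    rw [← map_smul, eq_comm, sharp_eq_iff hH]
    intro v
    rw [_root_.smul_apply, ← h, ← apply_sharp hW α, warp_apply, sharp_apply hW]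
    simp [← mul_assoc, ← Real.exp_add]
  rw [← gtrace_smul]
  simp only [gtrace]
  refine LinearMap.trace_prod_eq _ _ _ (fun u => ?_) (fun a => ?_)
  · exact h1 _ _ (hE u)
  · refine (h2 _ (LinearMap.toContinuousLinearMap (TF a)) (hF a)).trans ?_
    simp

/-- For base vectors, the base block of $u\mapsto R(u,v)w$ is that of $G$, while the fibre block is
the scalar $-(\mathrm{Hess}\,\varphi+d\varphi\otimes d\varphi)(v,w)$ times the identity; its trace
brings in the fibre dimension. -/
theorem ricci_warp_base (hG : IsMetricAt G p.1) (hH : IsMetricAt H p.2)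
    (hφ : ContDiffAt ℝ 2 φ p.1) (v w : E) :
    ricci (CoordGeom.warp G H φ) p (v, 0) (w, 0) = ricci G p.1 v w
      - Module.finrank ℝ F * (hess G φ p.1 v w + fderiv ℝ φ p.1 v * fderiv ℝ φ p.1 w) := by
  have := FiniteDimensional.complete ℝ E
  have := FiniteDimensional.complete ℝ F
  rw [ricci_apply, LinearMap.trace_prod_eq _ (riemann G p.1 v w).toLinearMap
    (-(hess G φ p.1 v w + fderiv ℝ φ p.1 v * fderiv ℝ φ p.1 w) • LinearMap.id)]
  · rw [map_smul, LinearMap.trace_id, ricci_apply, smul_eq_mul]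
    ring
  · intro u
    simp [riemann_apply, dChristoffel_warp hG hH hφ, christoffel_warp hG hH hφ]
  · intro a
    simp [riemann_apply, dChristoffel_warp hG hH hφ, christoffel_warp hG hH hφ, hess_apply]
    module

/-- With $n=\dim F$, the base block contributes
$-e^{2\varphi}H(b,c)(\square\varphi+|\nabla\varphi|^2)$. The fibre block is the curvature of $H$
minus a constant-curvature term of trace $(n-1)e^{2\varphi}|\nabla\varphi|^2H(b,c)$. -/
theorem ricci_warp_fiber (hG : IsMetricAt G p.1) (hH : IsMetricAt H p.2)
    (hφ : ContDiffAt ℝ 2 φ p.1) (b c : F) :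
    ricci (CoordGeom.warp G H φ) p (0, b) (0, c) = ricci H p.2 b c
      - Real.exp (2 * φ p.1) * (box G φ p.1 + Module.finrank ℝ F * gradSq G φ p.1)
        * H p.2 b c := by
  have := FiniteDimensional.complete ℝ E
  have := FiniteDimensional.complete ℝ F
  rw [ricci_apply, LinearMap.trace_prod_eq _
    (-(Real.exp (2 * φ p.1) * H p.2 b c) •
      ((fderiv ℝ φ p.1).toLinearMap.smulRight (grad G φ p.1)
        + ((fderiv ℝ (grad G φ) p.1).toLinearMap
          + ((christoffel G p.1).flip (grad G φ p.1)).toLinearMap)))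
    ((riemann H p.2 b c).toLinearMap - (Real.exp (2 * φ p.1) * gradSq G φ p.1) •
      (H p.2 b c • LinearMap.id - ((H p.2).flip c).toLinearMap.smulRight b))]
  · simp only [map_smul, map_sub, map_add (LinearMap.trace ℝ E), LinearMap.trace_id,
      LinearMap.trace_smulRight, ricci_apply]
    rw [← map_add, ← hG.box_eq hφ, gradSq_eq]
    simp
    ring
  · intro u
    simp [riemann_apply, dChristoffel_warp hG hH hφ, christoffel_warp hG hH hφ]
    module
  · intro a
    simp [riemann_apply, dChristoffel_warp hG hH hφ, christoffel_warp hG hH hφ, gradSq_eq]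
    module

theorem scalar_warp (hG : IsMetricAt G p.1) (hH : IsMetricAt H p.2)
    (hφ : ContDiffAt ℝ 2 φ p.1) :
    scalar (CoordGeom.warp G H φ) p = scalar G p.1
      + Real.exp (-(2 * φ p.1)) * scalar H p.2
      - 2 * Module.finrank ℝ F * box G φ p.1
      - Module.finrank ℝ F * (Module.finrank ℝ F + 1) * gradSq G φ p.1 := by
  -- This is $d\varphi\otimes d\varphi$, whose trace is $|\nabla\varphi|^2$. In the fibre trace,
  -- $e^{-2\varphi}$ cancels the $e^{2\varphi}$ of the fibre Ricci tensor.
  let D : LinearMap.BilinForm ℝ E :=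
    (ContinuousLinearMap.smulRightL ℝ E ℝ (fderiv ℝ φ p.1) ∘L fderiv ℝ φ p.1).toLinearMap₁₂
  rw [scalar, gtrace_warp hG.inv hH.inv _
    (ricci G p.1 + (-(Module.finrank ℝ F : ℝ)) • (hess G φ p.1 + D))
    (ricci H p.2 + (-(Real.exp (2 * φ p.1) *
      (box G φ p.1 + Module.finrank ℝ F * gradSq G φ p.1))) • (H p.2).toLinearMap₁₂)]
  · have hD : gtrace (G p.1) D = gradSq G φ p.1 :=
      gtrace_mul _ _ _ fun u v => by simp [D, mul_comm]
    rw [gtrace_add, gtrace_add, gtrace_smul, gtrace_smul, gtrace_add, hD,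
      gtrace_self hH.inv (H p.2).toLinearMap₁₂ fun _ _ => rfl, scalar, scalar, box]
    have := Real.exp_ne_zero (2 * φ p.1)
    rw [Real.exp_neg]
    field_simp
    ring
  · intro u v
    rw [ricci_warp_base hG hH hφ]
    simp [D]
    ring
  · intro a b
    rw [ricci_warp_fiber hG hH hφ]
    simp
    ring

end WarpCurvature

end CoordGeom

/-! ### Causal vectors -/

section Lorentz

/-- If a symmetric bilinear form is positive definite on the orthogonal complement of some vector,
two causal vectors on the same side of a timelike vector have nonpositive product. -/
theorem LinearMap.BilinForm.nonpos_of_causal {V : Type*} [AddCommGroup V] [Module ℝ V]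
    (B : LinearMap.BilinForm ℝ V) (hsymm : ∀ u v, B u v = B v u) {t : V}
    (ht : ∀ v, B t v = 0 → v ≠ 0 → 0 < B v v) {T u v : V} (hT : B T T < 0)
    (hu : B u u ≤ 0) (hTu : B T u < 0) (hv : B v v ≤ 0) (hTv : B T v < 0) : B u v ≤ 0 := by
  -- If $w\perp T$ had $B(w,w)<0$, the form would be negative definite on the plane spanned by $T$
  -- and $w$. That plane meets the hyperplane $t^\perp$, where the form is positive definite.
  have key : ∀ w, B T w = 0 → 0 ≤ B w w := by
    intro w hw
    by_contra! hneg
    have hT0 : B t T ≠ 0 := fun h0 => by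
      have := ht T h0 (by rintro rfl; simp at hT)
      linarith
    have hz : B t (B t w • T - B t T • w) = 0 := by
      simp; ring
    have hval : B (B t w • T - B t T • w) (B t w • T - B t T • w)
        = B t w ^ 2 * B T T + B t T ^ 2 * B w w := by
      simp [hw, hsymm w T]; ring
    have h1 : B t T ^ 2 * B w w < 0 := mul_neg_of_pos_of_neg (by positivity) hneg
    have h2 : B t w ^ 2 * B T T ≤ 0 := mul_nonpos_of_nonneg_of_nonpos (by positivity) hT.le
    by_cases h0 : B t w • T - B t T • w = 0
    · rw [h0] at hval
      simp at hval
      linarith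
    · have := ht _ hz h0
      linarith
  -- This combination of $u$ and $v$ is orthogonal to $T$. In its square the coefficient of $B(u,v)$
  -- is negative and the other terms are nonpositive, which forces the sign of $B(u,v)$.
  have h := key (B T v • u - B T u • v) (by simp; ring)
  have hval : B (B T v • u - B T u • v) (B T v • u - B T u • v)
      = B T v ^ 2 * B u u + B T u ^ 2 * B v v - 2 * (B T u * B T v) * B u v := by
    simp [hsymm v u]; ring
  rw [hval] at h
  have h1 : B T v ^ 2 * B u u ≤ 0 := mul_nonpos_of_nonneg_of_nonpos (by positivity) hu
  have h2 : B T u ^ 2 * B v v ≤ 0 := mul_nonpos_of_nonneg_of_nonpos (by positivity) hv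
  have h3 : 0 < B T u * B T v := mul_pos_of_neg_of_neg hTu hTv
  by_contra! h4
  have := mul_pos h3 h4
  linarith

theorem LorentzMetric.nondegenerate {E : Type*} [NormedAddCommGroup E] [NormedSpace ℝ E]
    {H : Type*} [TopologicalSpace H] {I : ModelWithCorners ℝ E H}
    {M : Type*} [TopologicalSpace M] [ChartedSpace H M] [IsManifold I ∞ M] (g : LorentzMetric I M)
    (x : M) (u : TangentSpace I x) (hu : ∀ v, g.val x u v = 0) : u = 0 := by
  obtain ⟨t, -, ht⟩ := g.signature x
  by_contra hne
  exact (ht u (by rw [g.symm, hu]) hne).ne' (hu u)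

end Lorentz

/-! ### Metrics in charts -/

section Charts

theorem ContinuousLinearMap.isInvertible_of_nondegenerate {E : Type*} [NormedAddCommGroup E]
    [NormedSpace ℝ E] [FiniteDimensional ℝ E] (B : E →L[ℝ] E →L[ℝ] ℝ)
    (hB : ∀ u, (∀ v, B u v = 0) → u = 0) : B.IsInvertible := by
  have hinj : Function.Injective B.toLinearMap :=
    (injective_iff_map_eq_zero B.toLinearMap).2 fun u hu => hB u fun v => by
      have := congrArg (fun L : E →L[ℝ] ℝ => L v) hu
      exact this
  have hdim : Module.finrank ℝ E = Module.finrank ℝ (E →L[ℝ] ℝ) := by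
    rw [← (LinearMap.toContinuousLinearMap (𝕜 := ℝ) (E := E) (F' := ℝ)).finrank_eq]
    exact Subspace.dual_finrank_eq.symm
  refine ⟨(LinearEquiv.ofInjectiveOfFinrankEq B.toLinearMap hinj hdim).toContinuousLinearEquiv, ?_⟩
  ext u v
  rfl

namespace Geom

variable {E : Type*} [NormedAddCommGroup E] [NormedSpace ℝ E]
  {H : Type*} [TopologicalSpace H] {I : ModelWithCorners ℝ E H}
  {M : Type*} [TopologicalSpace M] [ChartedSpace H M] [IsManifold I ∞ M]

theorem toCoord_eq (p : M) (u : TangentSpace I p) : toCoord I p u = u := by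
  have : IsManifold I 1 M := IsManifold.of_le (n := ∞) (by simp)
  rw [toCoord, mfderiv_extChartAt_self]
  rfl

variable [I.Boundaryless]

theorem mdifferentiableAt_extChartAt_symm {p : M} {y : E} (hy : y ∈ (extChartAt I p).target) :
    MDifferentiableAt 𝓘(ℝ, E) I (extChartAt I p).symm y := by
  have : IsManifold I 1 M := IsManifold.of_le (n := ∞) (by simp)
  have h := mdifferentiableWithinAt_extChartAt_symm (I := I) hy
  rwa [I.range_eq_univ, mdifferentiableWithinAt_univ] at h

theorem coordFrame_isInvertible {p : M} {y : E} (hy : y ∈ (extChartAt I p).target) :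
    (coordFrame I p y).IsInvertible := by
  have : IsManifold I 1 M := IsManifold.of_le (n := ∞) (by simp)
  have h := isInvertible_mfderivWithin_extChartAt_symm (I := I) hy
  rwa [I.range_eq_univ, mfderivWithin_univ] at h

theorem coordFrame_eq_symmL {p : M} {x : M} (hx : x ∈ (extChartAt I p).source) (u : E) :
    (trivializationAt E (TangentSpace I) p).symmL ℝ x u =
      coordFrame I p (extChartAt I p x) u := by
  have : IsManifold I 1 M := IsManifold.of_le (n := ∞) (by simp)
  rw [TangentBundle.symmL_trivializationAt (by simpa using hx), I.range_eq_univ,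
    mfderivWithin_univ]
  rfl

/-- Smoothness of a section of the hom bundle is smoothness of its expression in the trivialization
at $p$. Since that trivialization is inverse to the coordinate frame, the expression agrees with
`coordMetric` near the point. -/
theorem contDiffAt_coordMetric (g : TwoTensor I M)
    (hg : ContMDiff I (I.prod 𝓘(ℝ, E →L[ℝ] E →L[ℝ] ℝ)) ∞
      (fun x => Bundle.TotalSpace.mk' (E →L[ℝ] E →L[ℝ] ℝ)
        (E := fun x : M => TangentSpace I x →L[ℝ] TangentSpace I x →L[ℝ] ℝ) x (g x))) (p : M) :
    ContDiffAt ℝ 2 (coordMetric g p) (extChartAt I p p) := by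
  have h1 := ((contMDiffAt_hom_bundle _).1 (hg p)).2
  have h2 : ContMDiffAt 𝓘(ℝ, E) I ∞ (extChartAt I p).symm (extChartAt I p p) :=
    (contMDiffOn_extChartAt_symm p).contMDiffAt (extChartAt_target_mem_nhds p)
  have h3 := (h1.comp_of_eq h2 (by simp)).contDiffAt.of_le (m := 2) (by norm_cast)
  refine h3.congr_of_eventuallyEq ?_
  filter_upwards [extChartAt_target_mem_nhds (I := I) p] with y hy
  refine ContinuousLinearMap.ext fun u => ContinuousLinearMap.ext fun v => ?_
  set x := (extChartAt I p).symm y with hx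
  have hxs : x ∈ (extChartAt I p).source := (extChartAt I p).map_target hy
  have hy' : extChartAt I p x = y := (extChartAt I p).right_inv hy
  have hmem : x ∈ (trivializationAt (E →L[ℝ] ℝ)
      (fun x : M => TangentSpace I x →L[ℝ] ℝ) p).baseSet := by
    simpa using hxs
  have hframe : ∀ u, (trivializationAt E (TangentSpace I) p).symmL ℝ x u = coordFrame I p y u := by
    intro u
    have := coordFrame_eq_symmL (I := I) hxs u
    rw [hy'] at this
    exact this
  -- The cotangent trivialization precomposes with the inverse tangent trivialization; the trivial
  -- line bundle adds only the identity.
  have key : ∀ α : TangentSpace I x →L[ℝ] ℝ, (trivializationAt (E →L[ℝ] ℝ)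
      (fun x : M => TangentSpace I x →L[ℝ] ℝ) p).continuousLinearMapAt ℝ x α v
        = α ((trivializationAt E (TangentSpace I) p).symmL ℝ x v) := by
    intro α
    rw [Bundle.Trivialization.continuousLinearMapAt_apply,
      Bundle.Trivialization.coe_linearMapAt_of_mem _ hmem]
    have hid : (trivializationAt ℝ (Bundle.Trivial M ℝ) p).continuousLinearMapAt ℝ x =
        ContinuousLinearMap.id ℝ ℝ := Bundle.Trivial.continuousLinearMapAt_trivialization ℝ M ℝ x
    exact congrArg (fun L : ℝ →L[ℝ] ℝ =>
      L (α ((trivializationAt E (TangentSpace I) p).symmL ℝ x v))) hid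
  rw [coordMetric_apply]
  refine Eq.symm ((key _).trans ?_)
  rw [hframe]
  exact congrArg (fun a => g x a (coordFrame I p y v)) (hframe u)

/-- A smooth nondegenerate symmetric two-tensor is a metric in the preferred charts. -/
theorem isMetricAt_coordMetric [FiniteDimensional ℝ E] (g : TwoTensor I M)
    (hg : ContMDiff I (I.prod 𝓘(ℝ, E →L[ℝ] E →L[ℝ] ℝ)) ∞
      (fun x => Bundle.TotalSpace.mk' (E →L[ℝ] E →L[ℝ] ℝ)
        (E := fun x : M => TangentSpace I x →L[ℝ] TangentSpace I x →L[ℝ] ℝ) x (g x)))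
    (hsymm : ∀ x u v, g x u v = g x v u)
    (hnd : ∀ x u, (∀ v, g x u v = 0) → u = 0) (p : M) :
    CoordGeom.IsMetricAt (coordMetric g p) (extChartAt I p p) where
  contDiffAt := contDiffAt_coordMetric g hg p
  symm := Eventually.of_forall fun y u v => hsymm _ _ _
  inv := by
    refine ContinuousLinearMap.isInvertible_of_nondegenerate _ fun u hu => ?_
    have hy := mem_extChartAt_target (I := I) p
    have hi := coordFrame_isInvertible hy
    have h0 := hnd ((extChartAt I p).symm (extChartAt I p p))
      (coordFrame I p (extChartAt I p p) u) fun v => by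
        obtain ⟨w, rfl⟩ := hi.surjective v
        exact hu w
    exact hi.injective (h0.trans (map_zero _).symm)

omit [IsManifold I ∞ M] in
theorem contDiffAt_coordFun [IsManifold I ∞ M] {f : M → ℝ} (hf : ContMDiff I 𝓘(ℝ, ℝ) 2 f) (p : M) :
    ContDiffAt ℝ 2 (coordFun (I := I) f p) (extChartAt I p p) := by
  have h2 : ContMDiffAt 𝓘(ℝ, E) I ∞ (extChartAt I p).symm (extChartAt I p p) :=
    (contMDiffOn_extChartAt_symm p).contMDiffAt (extChartAt_target_mem_nhds p)
  exact ((hf _).comp _ (h2.of_le (by norm_cast))).contDiffAt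

omit [IsManifold I ∞ M] in
theorem differential_eq {f : M → ℝ} (hf : ContMDiff I 𝓘(ℝ, ℝ) 2 f) (p : M)
    (u : TangentSpace I p) :
    differential f p u = fderiv ℝ (coordFun (I := I) f p) (extChartAt I p p) u := by
  rw [differential, ((hf p).mdifferentiableAt (by simp)).mfderiv, I.range_eq_univ,
    fderivWithin_univ]
  rfl

/-! ### The warped metric in product charts and its Einstein tensor. -/

section Product

variable {F : Type*} [NormedAddCommGroup F] [NormedSpace ℝ F]
  {K : Type*} [TopologicalSpace K] {J : ModelWithCorners ℝ F K} [J.Boundaryless]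
  {S : Type*} [TopologicalSpace S] [ChartedSpace K S] [IsManifold J ∞ S]

-- The two derivatives land in different tangent spaces, so they are compared in the model space
-- `E`.
omit [I.Boundaryless] [IsManifold I ∞ M] in
theorem mfderiv_congr_apply {X : Type*} [NormedAddCommGroup X] [NormedSpace ℝ X] {f f' : X → M}
    (h : f = f') (y u : X) :
    (show E from mfderiv 𝓘(ℝ, X) I f y u) = mfderiv 𝓘(ℝ, X) I f' y u := by
  subst h; rfl

/-- The preferred chart of the product is the product chart, so the projection commutes with the
inverse charts; the chain rule on both sides gives the claim. -/
theorem dfst_coordFrame {q : M} {r : S} {y : E × F}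
    (hy : y ∈ (extChartAt (I.prod J) (q, r)).target) (u : E × F) :
    dfst I J ((extChartAt (I.prod J) (q, r)).symm y) (coordFrame (I.prod J) (q, r) y u) =
      coordFrame I q y.1 u.1 := by
  have hy1 : y.1 ∈ (extChartAt I q).target := by
    rw [extChartAt_prod] at hy; exact hy.1
  have h1 := (mdifferentiableAt_fst (I := I) (I' := J)
    (x := (extChartAt (I.prod J) (q, r)).symm y)).hasMFDerivAt.comp y
    (mdifferentiableAt_extChartAt_symm hy).hasMFDerivAt
  have h2 := (mdifferentiableAt_extChartAt_symm hy1).hasMFDerivAt.comp y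
    (hasFDerivAt_fst (𝕜 := ℝ) (p := y)).hasMFDerivAt
  have h3 : (Prod.fst : M × S → M) ∘ (extChartAt (I.prod J) (q, r)).symm =
      (extChartAt I q).symm ∘ (Prod.fst : E × F → E) := by
    rw [extChartAt_prod]; rfl
  exact (congrArg (fun L : E × F →L[ℝ] E => L u) h1.mfderiv.symm).trans
    ((mfderiv_congr_apply h3 y u).trans (congrArg (fun L : E × F →L[ℝ] E => L u) h2.mfderiv))

theorem dsnd_coordFrame {q : M} {r : S} {y : E × F}
    (hy : y ∈ (extChartAt (I.prod J) (q, r)).target) (u : E × F) :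
    dsnd I J ((extChartAt (I.prod J) (q, r)).symm y) (coordFrame (I.prod J) (q, r) y u) =
      coordFrame J r y.2 u.2 := by
  have hy2 : y.2 ∈ (extChartAt J r).target := by
    rw [extChartAt_prod] at hy; exact hy.2
  have h1 := (mdifferentiableAt_snd (I := I) (I' := J)
    (x := (extChartAt (I.prod J) (q, r)).symm y)).hasMFDerivAt.comp y
    (mdifferentiableAt_extChartAt_symm hy).hasMFDerivAt
  have h2 := (mdifferentiableAt_extChartAt_symm hy2).hasMFDerivAt.comp y
    (hasFDerivAt_snd (𝕜 := ℝ) (p := y)).hasMFDerivAt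
  have h3 : (Prod.snd : M × S → S) ∘ (extChartAt (I.prod J) (q, r)).symm =
      (extChartAt J r).symm ∘ (Prod.snd : E × F → F) := by
    rw [extChartAt_prod]; rfl
  exact (congrArg (fun L : E × F →L[ℝ] F => L u) h1.mfderiv.symm).trans
    ((mfderiv_congr_apply h3 y u).trans (congrArg (fun L : E × F →L[ℝ] F => L u) h2.mfderiv))

omit [I.Boundaryless] [IsManifold I ∞ M] in
theorem twoTensor_congr (g : TwoTensor I M) {x x' : M} (hx : x = x') {a a' b b' : E}
    (ha : a = a') (hb : b = b') : (g x : E →L[ℝ] E →L[ℝ] ℝ) a b = g x' a' b' := by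
  subst hx ha hb; rfl

/-- In the preferred charts, the warped product metric is a warped product. -/
theorem coordMetric_warpedMetric (g : TwoTensor I M) (h : TwoTensor J S) (f : M → ℝ) (m : ℝ)
    (q : M) (r : S) :
    coordMetric (warpedMetric g h f m) (q, r) =ᶠ[𝓝 (extChartAt (I.prod J) (q, r) (q, r))]
      CoordGeom.warp (coordMetric g q) (coordMetric h r)
        (fun y => -1 / m * coordFun (I := I) f q y) := by
  filter_upwards [extChartAt_target_mem_nhds (I := I.prod J) (q, r)] with y hy
  refine ContinuousLinearMap.ext fun u => ContinuousLinearMap.ext fun v => ?_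
  have hx1 : ((extChartAt (I.prod J) (q, r)).symm y).1 = (extChartAt I q).symm y.1 := by
    rw [extChartAt_prod]; rfl
  have hx2 : ((extChartAt (I.prod J) (q, r)).symm y).2 = (extChartAt J r).symm y.2 := by
    rw [extChartAt_prod]; rfl
  rw [coordMetric_apply, warpedMetric_apply, CoordGeom.warp_apply]
  refine congrArg₂ _ ?_ (congrArg₂ _ ?_ ?_)
  · exact twoTensor_congr g hx1 (dfst_coordFrame hy u) (dfst_coordFrame hy v)
  · rw [hx1, coordFun]
    congr 1
    ring
  · exact twoTensor_congr h hx2 (dsnd_coordFrame hy u) (dsnd_coordFrame hy v)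

/-- The Einstein tensor of a warped product in base directions. -/
theorem einstein_warpedMetric [FiniteDimensional ℝ E] [FiniteDimensional ℝ F]
    (m : ℕ) (hm : 0 < m) (hdim : Module.finrank ℝ F = m) (g : TwoTensor I M) (h : TwoTensor J S)
    {q : M} {r : S} (hg : CoordGeom.IsMetricAt (coordMetric g q) (extChartAt I q q))
    (hh : CoordGeom.IsMetricAt (coordMetric h r) (extChartAt J r r))
    {f : M → ℝ} (hf : ContMDiff I 𝓘(ℝ, ℝ) 2 f) (U V : TangentSpace I q) :
    einstein (warpedMetric g h f m) (q, r) (pushBase I J q r U) (pushBase I J q r V) =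
      einsteinBE g f m q U V - 1 / 2 * (Real.exp (2 * f q / m) * scalar h r) * g q U V := by
  have hp : ∀ U : TangentSpace I q, toCoord (I.prod J) (q, r) (pushBase I J q r U) =
      ((toCoord I q U, 0) : E × F) := by
    intro U
    rw [toCoord_eq, toCoord_eq, pushBase, mfderiv_prod_left]
    rfl
  have hd : ∀ U : TangentSpace I q, dfst I J (q, r) (pushBase I J q r U) = U := by
    intro U
    rw [dfst, pushBase, mfderiv_prod_left, mfderiv_fst]
    rfl
  have hs : ∀ U : TangentSpace I q, dsnd I J (q, r) (pushBase I J q r U) = 0 := by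
    intro U
    rw [dsnd, pushBase, mfderiv_prod_left, mfderiv_snd]
    rfl
  have hgUV : warpedMetric g h f m (q, r) (pushBase I J q r U) (pushBase I J q r V) =
      g q U V := by
    rw [warpedMetric_apply, hd, hd, hs, map_zero]
    simp
  have hφ := contDiffAt_coordFun hf q
  have hψ : ContDiffAt ℝ 2 (fun y => -1 / (m : ℝ) * coordFun (I := I) f q y)
      (extChartAt I q q) := contDiffAt_const.mul hφ
  have hm' : (m : ℝ) ≠ 0 := by positivity
  have hpt : extChartAt (I.prod J) (q, r) (q, r) = (extChartAt I q q, extChartAt J r r) := by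
    rw [extChartAt_prod]; rfl
  have hW := coordMetric_warpedMetric g h f m q r
  -- With $\varphi=-f/m$, $-m(\mathrm{Hess}\,\varphi+d\varphi\otimes
  -- d\varphi)=\mathrm{Hess}f-\tfrac1m df\otimes df$.
  have hric : ricci (warpedMetric g h f m) (q, r) (pushBase I J q r U) (pushBase I J q r V) =
      ricciBE g f m q U V := by
    rw [ricci, hp, hp, CoordGeom.ricci_congr hW, hpt,
      CoordGeom.ricci_warp_base (p := (extChartAt I q q, extChartAt J r r)) hg hh hψ, ricciBE,
      ricci, hess, differential_eq hf, differential_eq hf, hdim, CoordGeom.hess_const_mul,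
      CoordGeom.fderiv_const_mul_apply, CoordGeom.fderiv_const_mul_apply, toCoord_eq, toCoord_eq]
    field_simp
    ring
  -- Likewise $-2m\,\square\varphi=2\,\square f$ and
  -- $-m(m+1)|\nabla\varphi|^2=-\tfrac{m+1}{m}|\nabla f|^2$.
  have hsc : scalar (warpedMetric g h f m) (q, r) =
      scalarBE g f m q + Real.exp (2 * f q / m) * scalar h r := by
    rw [scalar, CoordGeom.scalar_congr hW, hpt,
      CoordGeom.scalar_warp (p := (extChartAt I q q, extChartAt J r r)) hg hh hψ, scalarBE,
      scalar, scalar, box, gradSq, hdim, CoordGeom.box_const_mul, CoordGeom.gradSq_const_mul]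
    have h1 : coordFun (I := I) f q (extChartAt I q q) = f q := by simp [coordFun]
    have h2 : -(2 * (-1 / (m : ℝ) * f q)) = 2 * f q / m := by ring
    simp only [h1, h2]
    field_simp
    ring
  rw [einstein, hric, hsc, hgUV, einsteinBE]
  ring

end Product

end Geom

end Charts

end

theorem lemma5p4
    {E : Type*} [NormedAddCommGroup E] [NormedSpace ℝ E] [FiniteDimensional ℝ E]
    {H : Type*} [TopologicalSpace H] {I : ModelWithCorners ℝ E H} [I.Boundaryless]
    {M : Type*} [TopologicalSpace M] [ChartedSpace H M] [IsManifold I ∞ M]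
    {F : Type*} [NormedAddCommGroup F] [NormedSpace ℝ F] [FiniteDimensional ℝ F]
    {K : Type*} [TopologicalSpace K] {J : ModelWithCorners ℝ F K} [J.Boundaryless]
    {S : Type*} [TopologicalSpace S] [ChartedSpace K S] [IsManifold J ∞ S]
    (m : ℕ) (hm : 0 < m) (hdim : Module.finrank ℝ F = m)
    (g : LorentzMetric I M) (T : TimeOrientation g)
    (h : Bundle.ContMDiffRiemannianMetric J ∞ F (TangentSpace J : S → Type _))
    (f : M → ℝ) (hf : ContMDiff I 𝓘(ℝ, ℝ) 2 f)
    (q : M) (r : S) (U V : TangentSpace I q)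
    (hU : T.IsFutureCausal U) (hV : T.IsFutureCausal V) :
    (0 ≤ Geom.einsteinBE g.val f m q U V → 0 ≤ Geom.scalar (I := J) h.inner r →
      0 ≤ Geom.einstein (Geom.warpedMetric (J := J) g.val h.inner f m) (q, r)
        (Geom.pushBase I J q r U) (Geom.pushBase I J q r V)) ∧
    (0 ≤ Geom.einstein (Geom.warpedMetric (J := J) g.val h.inner f m) (q, r)
        (Geom.pushBase I J q r U) (Geom.pushBase I J q r V) →
      Geom.scalar (I := J) h.inner r ≤ 0 →
      0 ≤ Geom.einsteinBE g.val f m q U V) := by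
  have hg := Geom.isMetricAt_coordMetric g.val g.contMDiff g.symm g.nondegenerate q
  have hh := Geom.isMetricAt_coordMetric (I := J) h.inner h.contMDiff h.symm
    (fun x u hu => by
      by_contra hne
      exact (h.pos x u hne).ne' (hu u)) r
  have hUV : g.val q U V ≤ 0 := by
    obtain ⟨t, -, ht⟩ := g.signature q
    exact LinearMap.BilinForm.nonpos_of_causal (V := TangentSpace I q) (g.val q).toLinearMap₁₂
      (g.symm q) ht (T.timelike q) hU.2.1 hU.2.2 hV.2.1 hV.2.2
  rw [Geom.einstein_warpedMetric m hm hdim g.val h.inner hg hh hf U V]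
  have hexp := Real.exp_pos (2 * f q / m)
  constructor
  · intro h1 h2
    have := mul_nonneg (mul_nonneg hexp.le h2) (neg_nonneg.2 hUV)
    linarith
  · intro h1 h2
    have := mul_nonneg (mul_nonneg hexp.le (neg_nonneg.2 h2)) (neg_nonneg.2 hUV)
    linarith
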